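/- For $u,v\in\mathbb Z^2$ and real $r$, let $B_r(u)=\{w\in\mathbb Z^2 : \|w-u\|_2\le r\}$ and, for $\Delta\ge 0$, $$S_{r,\Delta}(u,v)=\bigl(B_r(u)\setminus B_{r+\Delta}(v)\bigr)\cup\bigl(B_r(v)\setminus B_{r+\Delta}(u)\bigr).$$ A set $C\subseteq\mathbb Z^2$ is an $(r,\Delta)$-identifying code if $B_r(u)\cap C\neq\emptyset$ for every $u\in\mathbb Z^2$ and $S_{r,\Delta}(u,v)\cap C\neq\emptyset$ for all distinct $u,v\in\mathbb Z^2$. Let $\Delta_m(r)=\sup\{\Delta\ge 0 : \text{there is an }(r,\Delta)\text{-identifying code}\}$. The density of $C$ is $D(C)=\limsup_{n\to\infty}|C\cap Q_n|/|Q_n|$, where $Q_n=\{(x,y)\in\mathbb Z^2 : |x|\le n,\ |y|\le n\}$. For an integer $s\ge 1$, a set $U\subseteq\mathbb Z^2$ meets all diagonal (respectively anti-diagonal) lines modulo $s$ if for every $i\in\{0,\dots,s-1\}$ there is $(x,y)\in U$ with $y-x\equiv i \pmod s$ (respectively $x+y\equiv i\pmod s$). Let $L^d_s=\{(x,y)\in\mathbb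 Z^2 : y-x\equiv 0 \pmod s\}$. **Proposition.** Let $s\ge 1$ be an integer. There exists $r_0\in\mathbb N$ such that for every real $r\ge r_0$ and every $\Delta\in[0,\Delta_m(r)]$ the following hold. (i) The set $S_{r,\Delta}((0,0),(-1,-1))\cap\{(x,y) : x\ge 0,\ y\ge 0\}$ meets all diagonal lines modulo $s$ and all anti-diagonal lines modulo $s$. (ii) If, furthermore, $S_{r,\Delta}((0,0),(-1,0))$ meets all diagonal lines modulo $s$, then $L^d_s$ is an $(r,\Delta)$-identifying code, and its density is $1/s$. In particular, there is an $(r,\Delta)$-identifying code of density $1/s$. -/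

import Mathlib

noncomputable section

namespace TolerantCode

/-- Euclidean distance between two vertices of the square grid `ℤ²`. -/
def eDist (u v : ℤ × ℤ) : ℝ :=
  Real.sqrt (((u.1 : ℝ) - v.1) ^ 2 + ((u.2 : ℝ) - v.2) ^ 2)

/-- The Euclidean ball `B_r(u)` of `ℤ²`. -/
def ball (r : ℝ) (u : ℤ × ℤ) : Set (ℤ × ℤ) := {v | eDist v u ≤ r}

/-- `S_{r,Δ}(u,v) = (B_r(u) ∖ B_{r+Δ}(v)) ∪ (B_r(v) ∖ B_{r+Δ}(u))`. -/
def sep (r Δ : ℝ) (u v : ℤ × ℤ) : Set (ℤ × ℤ) :=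
  (ball r u \ ball (r + Δ) v) ∪ (ball r v \ ball (r + Δ) u)

/-- `C` is an `(r,Δ)`-tolerant identifying code of `ℤ²`. -/
def IsIdentifyingCode (r Δ : ℝ) (C : Set (ℤ × ℤ)) : Prop :=
  (∀ u, (ball r u ∩ C).Nonempty) ∧ ∀ u v, u ≠ v → (sep r Δ u v ∩ C).Nonempty

/-- `Δ_m(r)`: the supremum of the tolerances `Δ ≥ 0` for which an `(r,Δ)`-identifying code
exists. For `r ≥ 0` this is the supremum of a nonempty set bounded above by `1`. -/
def maxTolerance (r : ℝ) : ℝ := sSup {Δ : ℝ | 0 ≤ Δ ∧ ∃ C, IsIdentifyingCode r Δ C}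

/-- The square `Q_n = {(x,y) ∈ ℤ² : |x| ≤ n, |y| ≤ n}`. -/
def square (n : ℕ) : Set (ℤ × ℤ) := {p | |p.1| ≤ n ∧ |p.2| ≤ n}

/-- The density `D(C) = limsup_{n → ∞} |C ∩ Q_n| / |Q_n|`. -/
def density (C : Set (ℤ × ℤ)) : ℝ :=
  Filter.limsup (fun n : ℕ => ((C ∩ square n).ncard : ℝ) / ((square n).ncard : ℝ)) Filter.atTop

/-- `U` intersects all the diagonal lines modulo `k`. -/
def MeetsDiagonals (k : ℕ) (U : Set (ℤ × ℤ)) : Prop :=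
  ∀ i : ℕ, i < k → ∃ p ∈ U, p.2 - p.1 ≡ (i : ℤ) [ZMOD (k : ℤ)]

/-- `U` intersects all the anti-diagonal lines modulo `k`. -/
def MeetsAntidiagonals (k : ℕ) (U : Set (ℤ × ℤ)) : Prop :=
  ∀ i : ℕ, i < k → ∃ p ∈ U, p.1 + p.2 ≡ (i : ℤ) [ZMOD (k : ℤ)]

/-- The first quadrant of `ℤ²`. -/
def firstQuadrant : Set (ℤ × ℤ) := {p | 0 ≤ p.1 ∧ 0 ≤ p.2}

/-- The code `L^d_s = {(x,y) ∈ ℤ² : y - x ≡ 0 mod s}`. -/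
def diagonalLines (s : ℕ) : Set (ℤ × ℤ) := {p | p.2 - p.1 ≡ 0 [ZMOD (s : ℤ)]}

end TolerantCode

end

namespace TolerantCode

/-! Neighbouring centres force `Δ ≤ 1`, so a point within `r` of one centre separates once its
squared distance to the other exceeds `(r + 1) ^ 2`, about `2r` above `r ^ 2`. Just inside a large
circle, near an axis, lattice points exist in every residue class with squared norm deficit below a
quarter of the radius (`exists_modEq_near_circle`). Shifting the centre by `(-1, -1)` or `(-2, 0)`
gains about `2√2 r` or `4r` there, enough to absorb the deficit; `(-1, 0)` gains only about `2r`,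
hence the hypothesis in (ii). Translations and reflections reduce all other pairs to these three. -/

/-- Every residue class modulo `m` meets every real half-open interval of length `m`. -/
lemma exists_int_modEq_mem_Ioc {m : ℕ} (hm : 1 ≤ m) (i : ℤ) (T : ℝ) :
    ∃ n : ℤ, n ≡ i [ZMOD m] ∧ (n : ℝ) ≤ T ∧ T - m < n := by
  have hm' : (0 : ℝ) < m := by exact_mod_cast hm
  refine ⟨i + m * ⌊(T - i) / m⌋, by simp [Int.ModEq], ?_, ?_⟩
  · have h := mul_le_mul_of_nonneg_left (Int.floor_le ((T - i) / m)) hm'.le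
    rw [mul_div_cancel₀ _ hm'.ne'] at h
    push_cast
    linarith
  · have h := mul_lt_mul_of_pos_left (Int.lt_floor_add_one ((T - i) / m)) hm'
    rw [mul_div_cancel₀ _ hm'.ne'] at h
    push_cast
    linarith

/-- Just inside a large circle, close to the horizontal axis, there are lattice points with
prescribed residues modulo `m`. -/
lemma exists_modEq_near_circle {m : ℕ} (hm : 1 ≤ m) (i j : ℤ) {R : ℝ}
    (hR : 256 * (m : ℝ) ^ 3 ≤ R) :
    ∃ n c : ℤ, n ≡ i [ZMOD m] ∧ c ≡ j [ZMOD m] ∧ 0 ≤ c ∧ c ≤ n ∧ R - 2 * m < n ∧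
      (n : ℝ) ^ 2 + (c : ℝ) ^ 2 ≤ R ^ 2 ∧ R ^ 2 - R / 4 < (n : ℝ) ^ 2 + (c : ℝ) ^ 2 := by
  have hm' : (1 : ℝ) ≤ m := by exact_mod_cast hm
  have hm3 : (m : ℝ) ≤ (m : ℝ) ^ 3 := le_self_pow₀ hm' (by norm_num)
  -- Stopping at `R - m` keeps `R ^ 2 - n ^ 2 ≥ m ^ 2`, which leaves room for a nonnegative `c`.
  obtain ⟨n, hn, hn1, hn2⟩ := exists_int_modEq_mem_Ioc hm i (R - m)
  have hlow : (m : ℝ) ^ 2 ≤ R ^ 2 - (n : ℝ) ^ 2 := by nlinarith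
  have hupp : R ^ 2 - (n : ℝ) ^ 2 ≤ 4 * m * R := by nlinarith
  set t := Real.sqrt (R ^ 2 - (n : ℝ) ^ 2) with ht
  have ht0 : 0 ≤ t := Real.sqrt_nonneg _
  have ht2 : t ^ 2 = R ^ 2 - (n : ℝ) ^ 2 := Real.sq_sqrt (by nlinarith)
  have htm : (m : ℝ) ≤ t := Real.le_sqrt_of_sq_le hlow
  have htR : 8 * m * t ≤ R := by
    refine abs_le_of_sq_le_sq' ?_ (by linarith) |>.2
    calc (8 * m * t) ^ 2 = 64 * (m : ℝ) ^ 2 * t ^ 2 := by ring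
      _ ≤ 64 * (m : ℝ) ^ 2 * (4 * m * R) := by rw [ht2]; gcongr
      _ = 256 * (m : ℝ) ^ 3 * R := by ring
      _ ≤ R * R := by gcongr; linarith
      _ = R ^ 2 := by ring
  -- Since `t - c < m`, the deficit `t ^ 2 - c ^ 2` is below `2 * m * t ≤ R / 4`.
  obtain ⟨c, hc, hc1, hc2⟩ := exists_int_modEq_mem_Ioc hm j t
  have hc0 : (-1 : ℝ) < c := by linarith
  have hc0' : 0 ≤ c := by
    have : (-1 : ℤ) < c := by exact_mod_cast hc0
    omega
  have hc0'' : (0 : ℝ) ≤ c := by exact_mod_cast hc0'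
  refine ⟨n, c, hn, hc, hc0', ?_, by linarith, ?_, ?_⟩
  · have : (c : ℝ) ≤ n := by nlinarith
    exact_mod_cast this
  · nlinarith
  · nlinarith

lemma mem_ball_iff {r : ℝ} (hr : 0 ≤ r) (u w : ℤ × ℤ) :
    w ∈ ball r u ↔ ((w.1 : ℝ) - u.1) ^ 2 + ((w.2 : ℝ) - u.2) ^ 2 ≤ r ^ 2 :=
  Real.sqrt_le_left hr

lemma mem_sep_iff {r Δ : ℝ} (hr : 0 ≤ r) (hΔ : 0 ≤ Δ) (u v w : ℤ × ℤ) :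
    w ∈ sep r Δ u v ↔
      (((w.1 : ℝ) - u.1) ^ 2 + ((w.2 : ℝ) - u.2) ^ 2 ≤ r ^ 2 ∧
        (r + Δ) ^ 2 < ((w.1 : ℝ) - v.1) ^ 2 + ((w.2 : ℝ) - v.2) ^ 2) ∨
      (((w.1 : ℝ) - v.1) ^ 2 + ((w.2 : ℝ) - v.2) ^ 2 ≤ r ^ 2 ∧
        (r + Δ) ^ 2 < ((w.1 : ℝ) - u.1) ^ 2 + ((w.2 : ℝ) - u.2) ^ 2) := by
  simp only [sep, Set.mem_union, Set.mem_sdiff, mem_ball_iff hr, mem_ball_iff (add_nonneg hr hΔ),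
    not_le]

/-- By the triangle inequality, a point within `r` of one of two neighbours is within `r + 1` of the
other. -/
lemma maxTolerance_le_one {r : ℝ} (hr : 0 ≤ r) : maxTolerance r ≤ 1 := by
  refine Real.sSup_le ?_ zero_le_one
  rintro Δ ⟨hΔ, C, -, hC⟩
  obtain ⟨w, hw, -⟩ := hC (0, 0) (-1, 0) (by simp)
  rw [mem_sep_iff hr hΔ] at hw
  simp only [Int.cast_zero, Int.cast_neg, Int.cast_one, sub_zero, sub_neg_eq_add] at hw
  by_contra! h
  have h1 : (r + 1) ^ 2 ≤ (r + Δ) ^ 2 := by gcongr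
  rcases hw with ⟨h2, h3⟩ | ⟨h2, h3⟩
  · have : (w.1 : ℝ) ≤ r := le_of_sq_le_sq (by nlinarith) hr
    nlinarith
  · have : -((w.1 : ℝ) + 1) ≤ r := le_of_sq_le_sq (by nlinarith) hr
    nlinarith

/-- For large `r`, some point of the first quadrant with prescribed residues of `y - x` and
`x + y` separates the origin from `(-1, -1)`, with tolerance up to `1`. -/
lemma exists_mem_firstQuadrant_separating {s : ℕ} (hs : 1 ≤ s) {r : ℝ}
    (hr : 2048 * (s : ℝ) ^ 3 ≤ r) (i : ℤ) :
    ∃ p ∈ firstQuadrant, p.2 - p.1 ≡ i [ZMOD s] ∧ p.1 + p.2 ≡ i [ZMOD s] ∧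
      (p.1 : ℝ) ^ 2 + (p.2 : ℝ) ^ 2 ≤ r ^ 2 ∧
      (r + 1) ^ 2 < ((p.1 : ℝ) + 1) ^ 2 + ((p.2 : ℝ) + 1) ^ 2 := by
  have hs' : (1 : ℝ) ≤ s := by exact_mod_cast hs
  have hs3 : (s : ℝ) ≤ (s : ℝ) ^ 3 := le_self_pow₀ hs' (by norm_num)
  have hq : Real.sqrt 2 ^ 2 = 2 := Real.sq_sqrt (by norm_num)
  have hq1 : 1.4 ≤ Real.sqrt 2 := Real.le_sqrt_of_sq_le (by norm_num)
  have hR : 256 * ((2 * s : ℕ) : ℝ) ^ 3 ≤ Real.sqrt 2 * r := by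
    push_cast
    nlinarith
  -- Rotated coordinates `n = x + y`, `c = y - x` scale the radius by `√2`. The modulus `2 * s`
  -- gives `n` and `c` equal parity, so that `x` is an integer.
  obtain ⟨n, c, hn, hc, hc0, hcn, h1, h2, h3⟩ :=
    exists_modEq_near_circle (m := 2 * s) (by omega) i i hR
  push_cast at hn hc h1
  obtain ⟨x, hx⟩ : (2 : ℤ) ∣ n - c := (Dvd.intro _ rfl).trans (hc.trans hn.symm).dvd
  have hn' : (n : ℝ) = 2 * x + c := by
    have : n = 2 * x + c := by omega
    exact_mod_cast this
  refine ⟨(x, x + c), ⟨by simp only; omega, by simp only; omega⟩, ?_, ?_, ?_, ?_⟩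
  · simpa using hc.of_mul_left 2
  · rw [show x + (x + c) = n by omega]
    exact hn.of_mul_left 2
  · push_cast
    rw [mul_pow, hq, hn'] at h2
    nlinarith
  · push_cast
    rw [mul_pow, hq] at h3
    have h4 : 1.4 * r ≤ Real.sqrt 2 * r := by gcongr; nlinarith
    have h5 : ((x : ℝ) + 1) ^ 2 + (x + c + 1) ^ 2 = ((n : ℝ) ^ 2 + c ^ 2) / 2 + 2 * n + 2 := by
      rw [hn']; ring
    rw [h5]
    nlinarith

/-- For large `r`, some point with prescribed residue of `y - x` separates the origin from
`(-2, 0)`, with tolerance up to `1`. -/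
lemma exists_separating_horizontal {s : ℕ} (hs : 1 ≤ s) {r : ℝ}
    (hr : 2048 * (s : ℝ) ^ 3 ≤ r) (i : ℤ) :
    ∃ p : ℤ × ℤ, 0 ≤ p.1 ∧ p.2 - p.1 ≡ i [ZMOD s] ∧
      (p.1 : ℝ) ^ 2 + (p.2 : ℝ) ^ 2 ≤ r ^ 2 ∧
      (r + 1) ^ 2 < ((p.1 : ℝ) + 2) ^ 2 + (p.2 : ℝ) ^ 2 := by
  have hs' : (1 : ℝ) ≤ s := by exact_mod_cast hs
  have hs3 : (s : ℝ) ≤ (s : ℝ) ^ 3 := le_self_pow₀ hs' (by norm_num)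
  obtain ⟨n, c, hn, hc, hc0, hcn, h1, h2, h3⟩ :=
    exists_modEq_near_circle hs 0 i (R := r) (by linarith)
  refine ⟨(n, c), hc0.trans hcn, by simpa using hc.sub hn, h2, ?_⟩
  simp only
  nlinarith

/-! ### Reduction of all pairs to three displacements -/

/-- The points separating `(0, 0)` from `(-a, -b)` meet all diagonals modulo `s`. -/
def SeparatedOnDiagonals (s : ℕ) (r Δ : ℝ) (a b : ℤ) : Prop :=
  ∀ i : ℤ, ∃ p ∈ sep r Δ (0, 0) (-a, -b), p.2 - p.1 ≡ i [ZMOD s]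

lemma exists_modEq_of_meetsDiagonals {s : ℕ} (hs : 1 ≤ s) {U : Set (ℤ × ℤ)}
    (h : MeetsDiagonals s U) (i : ℤ) : ∃ p ∈ U, p.2 - p.1 ≡ i [ZMOD s] := by
  have hs' : (0 : ℤ) < s := by exact_mod_cast hs
  obtain ⟨p, hp, hpi⟩ := h (i % s).toNat (by have := Int.emod_lt_of_pos i hs'; omega)
  rw [Int.toNat_of_nonneg (Int.emod_nonneg _ hs'.ne')] at hpi
  exact ⟨p, hp, hpi.trans (Int.mod_modEq _ _)⟩

section

variable {s : ℕ} {r Δ : ℝ} {a b : ℤ}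

/-- Translating by `(a, b)` exchanges the roles of the two centres and shifts `y - x` by `b - a`. -/
lemma SeparatedOnDiagonals.neg (hr : 0 ≤ r) (hΔ : 0 ≤ Δ)
    (h : SeparatedOnDiagonals s r Δ a b) : SeparatedOnDiagonals s r Δ (-a) (-b) := by
  intro i
  obtain ⟨p, hp, hpi⟩ := h (i - (b - a))
  refine ⟨(p.1 + a, p.2 + b), ?_, ?_⟩
  · rw [mem_sep_iff hr hΔ] at hp ⊢
    push_cast at hp ⊢
    ring_nf at hp ⊢
    exact hp.symm
  · have := hpi.add_right (b - a)
    ring_nf at this ⊢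
    exact this

lemma SeparatedOnDiagonals.swap (hr : 0 ≤ r) (hΔ : 0 ≤ Δ)
    (h : SeparatedOnDiagonals s r Δ a b) : SeparatedOnDiagonals s r Δ b a := by
  intro i
  -- Reflection in the line `y = x` negates `y - x`.
  obtain ⟨p, hp, hpi⟩ := h (-i)
  refine ⟨(p.2, p.1), ?_, by simpa using hpi.neg⟩
  rw [mem_sep_iff hr hΔ] at hp ⊢
  simp only at hp ⊢
  simpa only [add_comm] using hp

lemma separatedOnDiagonals_of_pos (hs : 1 ≤ s) (hr : 2048 * (s : ℝ) ^ 3 ≤ r) (hΔ : 0 ≤ Δ)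
    (hΔ1 : Δ ≤ 1) (ha : 0 < a) (hb : 0 < b) : SeparatedOnDiagonals s r Δ a b := by
  have hr0 : 0 ≤ r := le_trans (by positivity) hr
  intro i
  obtain ⟨p, ⟨hx, hy⟩, hpi, -, h1, h2⟩ := exists_mem_firstQuadrant_separating hs hr i
  refine ⟨p, (mem_sep_iff hr0 hΔ _ _ _).2 (Or.inl ⟨by simpa using h1, ?_⟩), hpi⟩
  have hx' : (0 : ℝ) ≤ p.1 := by exact_mod_cast hx
  have hy' : (0 : ℝ) ≤ p.2 := by exact_mod_cast hy
  have ha' : (1 : ℝ) ≤ a := by exact_mod_cast ha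
  have hb' : (1 : ℝ) ≤ b := by exact_mod_cast hb
  push_cast
  rw [sub_neg_eq_add, sub_neg_eq_add]
  calc (r + Δ) ^ 2 ≤ (r + 1) ^ 2 := by gcongr
    _ < _ := h2
    _ ≤ _ := by gcongr

/-- Reflection in the horizontal axis turns diagonals into anti-diagonals, which is where the
residue of `x + y` is needed. -/
lemma separatedOnDiagonals_of_pos_neg (hs : 1 ≤ s) (hr : 2048 * (s : ℝ) ^ 3 ≤ r) (hΔ : 0 ≤ Δ)
    (hΔ1 : Δ ≤ 1) (ha : 0 < a) (hb : b < 0) : SeparatedOnDiagonals s r Δ a b := by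
  have hr0 : 0 ≤ r := le_trans (by positivity) hr
  intro i
  obtain ⟨p, ⟨hx, hy⟩, -, hpi, h1, h2⟩ := exists_mem_firstQuadrant_separating hs hr (-i)
  refine ⟨(p.1, -p.2), (mem_sep_iff hr0 hΔ _ _ _).2 (Or.inl ⟨by simpa using h1, ?_⟩), ?_⟩
  · have hx' : (0 : ℝ) ≤ p.1 := by exact_mod_cast hx
    have hy' : (0 : ℝ) ≤ p.2 := by exact_mod_cast hy
    have ha' : (1 : ℝ) ≤ a := by exact_mod_cast ha
    have hb' : (1 : ℝ) ≤ -b := by exact_mod_cast (by omega : 1 ≤ -b)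
    push_cast
    calc (r + Δ) ^ 2 ≤ (r + 1) ^ 2 := by gcongr
      _ < _ := h2
      _ ≤ ((p.1 : ℝ) + a) ^ 2 + ((p.2 : ℝ) + -b) ^ 2 := by gcongr
      _ = _ := by ring
  · have := hpi.neg
    rw [neg_neg] at this
    rwa [show -p.2 - p.1 = -(p.1 + p.2) by ring]

lemma separatedOnDiagonals_of_two_le (hs : 1 ≤ s) (hr : 2048 * (s : ℝ) ^ 3 ≤ r) (hΔ : 0 ≤ Δ)
    (hΔ1 : Δ ≤ 1) (ha : 2 ≤ a) : SeparatedOnDiagonals s r Δ a 0 := by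
  have hr0 : 0 ≤ r := le_trans (by positivity) hr
  intro i
  obtain ⟨p, hx, hpi, h1, h2⟩ := exists_separating_horizontal hs hr i
  refine ⟨p, (mem_sep_iff hr0 hΔ _ _ _).2 (Or.inl ⟨by simpa using h1, ?_⟩), hpi⟩
  have hx' : (0 : ℝ) ≤ p.1 := by exact_mod_cast hx
  have ha' : (2 : ℝ) ≤ a := by exact_mod_cast ha
  push_cast
  rw [sub_neg_eq_add, neg_zero, sub_zero]
  calc (r + Δ) ^ 2 ≤ (r + 1) ^ 2 := by gcongr
    _ < _ := h2
    _ ≤ _ := by gcongr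

lemma separatedOnDiagonals_of_ne_zero (hs : 1 ≤ s) (hr : 2048 * (s : ℝ) ^ 3 ≤ r) (hΔ : 0 ≤ Δ)
    (hΔ1 : Δ ≤ 1) (h : SeparatedOnDiagonals s r Δ 1 0) (hab : a ≠ 0 ∨ b ≠ 0) :
    SeparatedOnDiagonals s r Δ a b := by
  have hr0 : 0 ≤ r := le_trans (by positivity) hr
  have hpos : ∀ {c : ℤ}, 0 < c → SeparatedOnDiagonals s r Δ c 0 := by
    intro c hc
    obtain rfl | hc' : c = 1 ∨ 2 ≤ c := by omega
    · exact h
    · exact separatedOnDiagonals_of_two_le hs hr hΔ hΔ1 hc'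
  have hhor : ∀ {c : ℤ}, c ≠ 0 → SeparatedOnDiagonals s r Δ c 0 := by
    intro c hc
    rcases lt_or_gt_of_ne hc with hc' | hc'
    · simpa using (hpos (neg_pos.2 hc')).neg hr0 hΔ
    · exact hpos hc'
  rcases lt_trichotomy a 0 with ha | rfl | ha
  · rcases lt_trichotomy b 0 with hb | rfl | hb
    · simpa using (separatedOnDiagonals_of_pos hs hr hΔ hΔ1 (neg_pos.2 ha)
        (neg_pos.2 hb)).neg hr0 hΔ
    · exact hhor ha.ne
    · simpa using (separatedOnDiagonals_of_pos_neg hs hr hΔ hΔ1 (neg_pos.2 ha)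
        (neg_lt_zero.2 hb)).neg hr0 hΔ
  · exact (hhor (by simpa using hab)).swap hr0 hΔ
  · rcases lt_trichotomy b 0 with hb | rfl | hb
    · exact separatedOnDiagonals_of_pos_neg hs hr hΔ hΔ1 ha hb
    · exact hhor ha.ne'
    · exact separatedOnDiagonals_of_pos hs hr hΔ hΔ1 ha hb

lemma isIdentifyingCode_diagonalLines (hs : 1 ≤ s) (hr : (s : ℝ) ≤ r) (hΔ : 0 ≤ Δ)
    (h : ∀ a b : ℤ, a ≠ 0 ∨ b ≠ 0 → SeparatedOnDiagonals s r Δ a b) :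
    IsIdentifyingCode r Δ (diagonalLines s) := by
  have hr0 : 0 ≤ r := le_trans (by positivity) hr
  have hs' : (0 : ℤ) < s := by exact_mod_cast hs
  constructor
  · intro u
    have h1 := Int.emod_nonneg (u.2 - u.1) hs'.ne'
    have h2 := Int.emod_lt_of_pos (u.2 - u.1) hs'
    refine ⟨(u.1 + (u.2 - u.1) % s, u.2), ?_, ?_⟩
    · rw [mem_ball_iff hr0]
      push_cast
      have h1' : (0 : ℝ) ≤ ((u.2 - u.1) % s : ℤ) := by exact_mod_cast h1
      have h2' : (((u.2 - u.1) % s : ℤ) : ℝ) < s := by exact_mod_cast h2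
      ring_nf at h1' h2' ⊢
      nlinarith
    · change u.2 - (u.1 + (u.2 - u.1) % s) ≡ 0 [ZMOD s]
      rw [← sub_sub]
      simpa using (Int.ModEq.refl (u.2 - u.1)).sub (Int.mod_modEq (u.2 - u.1) s)
  · intro u v huv
    have hne : u.1 - v.1 ≠ 0 ∨ u.2 - v.2 ≠ 0 := by
      by_contra! hc
      exact huv (Prod.ext (sub_eq_zero.1 hc.1) (sub_eq_zero.1 hc.2))
    -- Translating `u` to the origin moves the code to another diagonal class, so every residue must
    -- be available.
    obtain ⟨p, hp, hpi⟩ := h _ _ hne (-(u.2 - u.1))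
    refine ⟨(p.1 + u.1, p.2 + u.2), ?_, ?_⟩
    · rw [mem_sep_iff hr0 hΔ] at hp ⊢
      push_cast at hp ⊢
      ring_nf at hp ⊢
      exact hp
    · have := hpi.add_right (u.2 - u.1)
      rw [neg_add_cancel] at this
      change p.2 + u.2 - (p.1 + u.1) ≡ 0 [ZMOD s]
      rwa [show p.2 + u.2 - (p.1 + u.1) = p.2 - p.1 + (u.2 - u.1) by ring]

end

/-! ### Density of the diagonal code -/

lemma square_eq_coe (n : ℕ) :
    square n = ((Finset.Icc (-n : ℤ) n ×ˢ Finset.Icc (-n : ℤ) n : Finset (ℤ × ℤ)) :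
      Set (ℤ × ℤ)) := by
  ext p
  simp only [square, abs_le, Set.mem_ofPred_eq, Finset.mem_coe, Finset.mem_product, Finset.mem_Icc]

lemma ncard_square (n : ℕ) : ((square n).ncard : ℝ) = (2 * n + 1) ^ 2 := by
  rw [square_eq_coe, Set.ncard_coe_finset, Finset.card_product, Int.card_Icc,
    show ((n : ℤ) + 1 - -n).toNat = 2 * n + 1 by omega]
  push_cast
  ring

/-- Number of points of a residue class in an integer interval, up to one. -/
lemma abs_card_filter_modEq_sub_le {s : ℕ} (hs : 1 ≤ s) (n : ℕ) (x : ℤ) :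
    |(((Finset.Icc (-n : ℤ) n).filter (fun y => y ≡ x [ZMOD s])).card : ℝ) -
      (2 * n + 1) / s| ≤ 1 := by
  have hs' : (0 : ℤ) < s := by exact_mod_cast hs
  have hI : Finset.Icc (-n : ℤ) n = Finset.Ioc (-n - 1 : ℤ) n := by
    ext y; simp only [Finset.mem_Icc, Finset.mem_Ioc]; omega
  have hcard := Int.Ioc_filter_modEq_card (-n - 1 : ℤ) n hs' x
  have hsq : (0 : ℚ) < s := by exact_mod_cast hs
  have hle : ((-n - 1 : ℤ) - x : ℚ) / ((s : ℤ) : ℚ) ≤ ((n : ℤ) - x : ℚ) / ((s : ℤ) : ℚ) := by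
    push_cast
    gcongr
    linarith [(Nat.cast_nonneg n : (0 : ℚ) ≤ n)]
  rw [max_eq_left (sub_nonneg.2 (Int.floor_le_floor hle)), ← hI] at hcard
  set N := ((Finset.Icc (-n : ℤ) n).filter (fun y => y ≡ x [ZMOD s])).card
  have hcardq : (N : ℚ) = ⌊((n : ℤ) - x : ℚ) / ((s : ℤ) : ℚ)⌋ -
      ⌊((-n - 1 : ℤ) - x : ℚ) / ((s : ℤ) : ℚ)⌋ := by exact_mod_cast hcard
  have hdiff : ((n : ℤ) - x : ℚ) / ((s : ℤ) : ℚ) - ((-n - 1 : ℤ) - x : ℚ) / ((s : ℤ) : ℚ) =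
      (2 * n + 1) / s := by
    push_cast
    ring
  have hq : |(N : ℚ) - (2 * n + 1) / s| ≤ 1 := by
    rw [hcardq, ← hdiff, abs_le]
    have h1 := Int.floor_le (((n : ℤ) - x : ℚ) / ((s : ℤ) : ℚ))
    have h2 := Int.lt_floor_add_one (((n : ℤ) - x : ℚ) / ((s : ℤ) : ℚ))
    have h3 := Int.floor_le (((-n - 1 : ℤ) - x : ℚ) / ((s : ℤ) : ℚ))
    have h4 := Int.lt_floor_add_one (((-n - 1 : ℤ) - x : ℚ) / ((s : ℤ) : ℚ))
    constructor <;> linarith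
  have hreal : ((|(N : ℚ) - (2 * n + 1) / s| : ℚ) : ℝ) ≤ ((1 : ℚ) : ℝ) := Rat.cast_le.2 hq
  push_cast at hreal
  exact hreal

lemma ncard_diagonalLines_inter_square (s n : ℕ) :
    (diagonalLines s ∩ square n).ncard =
      ∑ x ∈ Finset.Icc (-n : ℤ) n,
        ((Finset.Icc (-n : ℤ) n).filter (fun y => y ≡ x [ZMOD s])).card := by
  have h : diagonalLines s ∩ square n =
      ((Finset.Icc (-n : ℤ) n ×ˢ Finset.Icc (-n : ℤ) n).filter
        (fun p => p.2 ≡ p.1 [ZMOD s]) : Finset (ℤ × ℤ)) := by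
    ext p
    rw [square_eq_coe, Set.inter_comm, Finset.coe_filter]
    refine and_congr_right fun _ => ⟨fun hp => ?_, fun hp => ?_⟩
    · simpa using Int.ModEq.add_right p.1 (show p.2 - p.1 ≡ 0 [ZMOD s] from hp)
    · simpa [diagonalLines] using Int.ModEq.sub_right p.1 hp
  rw [h, Set.ncard_coe_finset, Finset.card_filter, Finset.sum_product]
  simp only [Finset.card_filter]

/-- Each of the `2n + 1` columns contributes `(2n + 1) / s` points up to an error of one, so the
relative error is at most `1 / (2n + 1)`. -/
lemma density_diagonalLines {s : ℕ} (hs : 1 ≤ s) :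
    density (diagonalLines s) = 1 / (s : ℝ) := by
  have hs' : (0 : ℝ) < s := by exact_mod_cast hs
  refine Filter.Tendsto.limsup_eq ?_
  have hlim : Filter.Tendsto (fun n : ℕ => (1 : ℝ) / (n + 1)) Filter.atTop (nhds 0) :=
    tendsto_one_div_add_atTop_nhds_zero_nat
  rw [tendsto_iff_dist_tendsto_zero]
  refine squeeze_zero (fun _ => dist_nonneg) (fun n => ?_) hlim
  have hn : (0 : ℝ) < 2 * n + 1 := by positivity
  have hsum : |((diagonalLines s ∩ square n).ncard : ℝ) - (2 * n + 1) * ((2 * n + 1) / s)| ≤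
      2 * n + 1 := by
    have hc : (((Finset.Icc (-n : ℤ) n).card : ℕ) : ℝ) = 2 * n + 1 := by
      rw [Int.card_Icc, show ((n : ℤ) + 1 - -n).toNat = 2 * n + 1 by omega]
      push_cast
      ring
    rw [ncard_diagonalLines_inter_square, ← hc, ← nsmul_eq_mul, ← Finset.sum_const, hc]
    push_cast
    rw [← Finset.sum_sub_distrib]
    refine (Finset.abs_sum_le_sum_abs _ _).trans
      ((Finset.sum_le_sum fun x _ => abs_card_filter_modEq_sub_le hs n x).trans ?_)
    simp only [Finset.sum_const, nsmul_eq_mul, mul_one]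
    exact hc.le
  rw [Real.dist_eq, ncard_square,
    show ((diagonalLines s ∩ square n).ncard : ℝ) / (2 * n + 1) ^ 2 - 1 / s =
      (((diagonalLines s ∩ square n).ncard : ℝ) - (2 * n + 1) * ((2 * n + 1) / s)) /
        (2 * n + 1) ^ 2 by field_simp, abs_div, abs_of_pos (pow_pos hn 2)]
  calc _ ≤ (2 * n + 1 : ℝ) / (2 * n + 1) ^ 2 := by gcongr
    _ = 1 / (2 * n + 1) := by field_simp
    _ ≤ 1 / (n + 1) := by
      gcongr
      linarith [(Nat.cast_nonneg n : (0 : ℝ) ≤ n)]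

end TolerantCode

theorem mainTheorem1 (s : ℕ) (hs : 1 ≤ s) :
    ∃ r₀ : ℕ, ∀ r : ℝ, (r₀ : ℝ) ≤ r →
      ∀ Δ : ℝ, 0 ≤ Δ → Δ ≤ TolerantCode.maxTolerance r →
        (TolerantCode.MeetsDiagonals s
            (TolerantCode.sep r Δ (0, 0) (-1, -1) ∩ TolerantCode.firstQuadrant) ∧
          TolerantCode.MeetsAntidiagonals s
            (TolerantCode.sep r Δ (0, 0) (-1, -1) ∩ TolerantCode.firstQuadrant)) ∧
        (TolerantCode.MeetsDiagonals s (TolerantCode.sep r Δ (0, 0) (-1, 0)) →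
          TolerantCode.IsIdentifyingCode r Δ (TolerantCode.diagonalLines s) ∧
          TolerantCode.density (TolerantCode.diagonalLines s) = 1 / (s : ℝ)) := by
  refine ⟨2048 * s ^ 3, fun r hr Δ hΔ hΔm => ?_⟩
  push_cast at hr
  have hr0 : 0 ≤ r := le_trans (by positivity) hr
  have hs' : (1 : ℝ) ≤ s := by exact_mod_cast hs
  have hsr : (s : ℝ) ≤ r := by
    have : (s : ℝ) ≤ (s : ℝ) ^ 3 := le_self_pow₀ hs' (by norm_num)
    linarith
  have hΔ1 : Δ ≤ 1 := hΔm.trans (TolerantCode.maxTolerance_le_one hr0)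
  have key : ∀ i : ℤ,
      ∃ p ∈ TolerantCode.sep r Δ (0, 0) (-1, -1) ∩ TolerantCode.firstQuadrant,
        p.2 - p.1 ≡ i [ZMOD s] ∧ p.1 + p.2 ≡ i [ZMOD s] := by
    intro i
    obtain ⟨p, hp, h1, h2, h3, h4⟩ :=
      TolerantCode.exists_mem_firstQuadrant_separating hs hr i
    refine ⟨p, ⟨(TolerantCode.mem_sep_iff hr0 hΔ _ _ _).2 (Or.inl ⟨by simpa using h3, ?_⟩), hp⟩,
      h1, h2⟩
    have h5 : (r + Δ) ^ 2 ≤ (r + 1) ^ 2 := by gcongr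
    simpa using h5.trans_lt h4
  refine ⟨⟨fun i _ => (key i).imp fun p hp => ⟨hp.1, hp.2.1⟩,
    fun i _ => (key i).imp fun p hp => ⟨hp.1, hp.2.2⟩⟩, fun h => ⟨?_, ?_⟩⟩
  · exact TolerantCode.isIdentifyingCode_diagonalLines hs hsr hΔ fun a b hab =>
      TolerantCode.separatedOnDiagonals_of_ne_zero hs hr hΔ hΔ1
        (TolerantCode.exists_modEq_of_meetsDiagonals hs (by simpa using h)) hab
  · exact TolerantCode.density_diagonalLines hs
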